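/- Consider the planar trident mechanism with configurations $q=(x,y,\theta,\varphi,\ell_1,\ell_2,\ell_3)\in\mathbb R^7$. Its wheels are at $$(x,y)+(\cos\beta_i,\sin\beta_i)+\ell_i(\cos\gamma_i,\sin\gamma_i),\qquad i=1,2,3,$$ where $\beta_1=\gamma_1=\theta-\tfrac{2\pi}3$, $\beta_2=\theta$, $\gamma_2=\theta+\varphi$, $\beta_3=\gamma_3=\theta+\tfrac{2\pi}3$. Let $\Omega=\{q\in\mathbb R^7:\ell_1,\ell_2,\ell_3>0\}$ and $L=\ell_1+\ell_3+2$. Let the horizontal distribution $\Delta$ be the solution space of the Pfaff system $$\begin{aligned} 0&=-\sin(\theta-\tfrac{2\pi}3)\,dx+\cos(\theta-\tfrac{2\pi}3)\,dy+(1+\ell_1)\,d\theta,\\ 0&=-\sin(\theta+\varphi)\,dx+\cos(\theta+\varphi)\,dy+(\cos\varphi+\ell_2)\,d\theta+\ell_2\,d\varphi,\\ 0&=-\sin(\theta+\tfrac{2\pi}3)\,dx+\cos(\theta+\tfrac{2\pi}3)\,dy+(1+\ell_3)\,d\theta . \end{aligned}$$ Put $a=\frac{(\ell_1-\ell_3)\sqrt3}{3L}$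 and $$X_1=(\sin\theta+a\cos\theta)\,\partial_x+(-\cos\theta+a\sin\theta)\,\partial_y-\tfrac1L\,\partial_\theta+\frac{\sqrt3\sin\varphi\,(\ell_1-\ell_3)+3\cos\varphi\,(L+1)+3\ell_2}{3\ell_2L}\,\partial_\varphi,$$ $X_2=\partial_{\ell_1}$, $X_3=\partial_{\ell_2}$, $X_4=\partial_{\ell_3}$, and $X_{1j}=[X_1,X_j]$ for $j=2,3,4$. Call $q$ regular if $S(q):=\sin\varphi\,(\ell_1-\ell_3)+\sqrt3\cos\varphi\,(L+1)\neq0$. Then the following hold. 1. For every $q\in\mathbb R^7$, a velocity $v$ lies in $\Delta(q)$ if and only if no wheel slips sideways, i.e. the velocity of each wheel $i$ is orthogonal to $(-\sin\gamma_i,\cos\gamma_i)$. 2. On $\Omega$ the vector fields $X_1,\dots,X_4$ are smooth and form a basis of $\Delta(q)$ at every point $q$. 3. At the points of $\Omega$ with $\theta=\frac\pi2$ one has $$X_1=\partial_x+a\,\partial_y-\tfrac1L\partial_\theta+\tfrac{\sqrt3\sin\varphi(\ell_1-\ell_3)+3\cos\varphi(L+1)+3\ell_2}{3\ell_2L}\partial_\varphi,$$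 $$X_{12}=\tfrac{-2(\ell_3+1)}{\sqrt3L^2}\partial_y-\tfrac1{L^2}\partial_\theta+\tfrac{-2\sin\varphi(\ell_3+1)+\sqrt3\cos\varphi+\sqrt3\ell_2}{\sqrt3\ell_2L^2}\partial_\varphi,\qquad X_{13}=\tfrac{S}{\sqrt3\,\ell_2^2L}\partial_\varphi,$$ $$X_{14}=\tfrac{2\ell_1+2}{\sqrt3L^2}\partial_y-\tfrac1{L^2}\partial_\theta+\tfrac{2\sin\varphi(\ell_1+1)+\sqrt3\cos\varphi+\sqrt3\ell_2}{\sqrt3\ell_2L^2}\partial_\varphi,$$ and $[X_i,X_j]=0$ everywhere for $i,j\in\{2,3,4\}$. 4. For $q\in\Omega$, the vectors $X_1,X_2,X_3,X_4,X_{12},X_{13},X_{14}$ span the tangent space $T_q\mathbb R^7$ if and only if $q$ is regular. Every $q\in\Omega$ with $|\varphi|\le\frac\pi3$ is regular. 5. At every regular $q\in\Omega$ the distribution $\Delta$ has growth vector $(4,7)$, i.e. $\dim\Delta^1(q)=4$ and $\dim\Delta^2(q)=7$, where $\Delta^1$ is spanned by the smooth sections of $\Delta$ over $\Omega$ and $\Delta^2=\Delta^1+[\Delta^1,\Delta^1]$.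 6. The system $\dot q=u_1X_1(q)+u_2X_2(q)+u_3X_3(q)+u_4X_4(q)$ is locally controllable at every $q\in\Omega$: for each neighbourhood $W$ of $q$ there is a neighbourhood $V$ of $q$ such that $q$ can be joined to every point of $V$ by a trajectory that stays in $W$. Moreover, any two points of $\Omega$ can be joined by a trajectory that stays in $\Omega$. Here a trajectory is a Lipschitz curve $[0,T]\to\mathbb R^7$, $T>0$, that satisfies the system almost everywhere for some bounded measurable control $u$. -/

import Mathlib

open scoped ContDiff Topology

noncomputable section

namespace Control

variable {E : Type*} [NormedAddCommGroup E] [NormedSpace ℝ E]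

/-- Smooth vector fields on `Ω` (extended arbitrarily off `Ω`) with values in the distribution `D`. -/
def smoothSections (Ω : Set E) (D : E → Submodule ℝ E) : Set (E → E) :=
  {X | ContDiffOn ℝ ∞ X Ω ∧ ∀ q ∈ Ω, X q ∈ D q}

/-- Generators of the flag `Δ¹ ⊆ Δ² ⊆ …` of the distribution `D` over the open set `Ω`:
`Δ¹ = Γ(D)` is `flagFields Ω D 0`, and `Δˢ⁺¹ = Δˢ + [Δ¹, Δˢ]`. -/
def flagFields (Ω : Set E) (D : E → Submodule ℝ E) : ℕ → Set (E → E)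
  | 0 => smoothSections Ω D
  | s + 1 => flagFields Ω D s ∪
      {Z | ∃ X ∈ smoothSections Ω D, ∃ Y ∈ flagFields Ω D s, Z = VectorField.lieBracket ℝ X Y}

/-- The subspace `Δˢ⁺¹(q)` of the tangent space at `q`. -/
def flagAt (Ω : Set E) (D : E → Submodule ℝ E) (s : ℕ) (q : E) : Submodule ℝ E :=
  Submodule.span ℝ ((fun X : E → E => X q) '' flagFields Ω D s)

/-- At `q` the distribution has growth vector `l = (dim Δ¹(q), …, dim Δʳ(q))`,
where `Δʳ(q)` is the whole tangent space. -/
def HasGrowthVectorAt (Ω : Set E) (D : E → Submodule ℝ E) (q : E) (l : List ℕ) : Prop :=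
  (∀ i : Fin l.length, Module.finrank ℝ (flagAt Ω D i q) = l.get i) ∧
    l.getLast? = some (Module.finrank ℝ E)

/-- `γ : [0, T] → E` is a trajectory of the driftless control system `q' = ∑ i, u i • X i q` for
the bounded measurable control `u`: a Lipschitz curve satisfying the equation almost everywhere. -/
structure IsTrajectory {m : ℕ} (X : Fin m → E → E) (T : ℝ) (u : ℝ → Fin m → ℝ) (γ : ℝ → E) :
    Prop where
  measurable : Measurable u
  bounded : ∃ C : ℝ, ∀ t, ‖u t‖ ≤ C
  lipschitz : ∃ K, LipschitzOnWith K γ (Set.Icc 0 T)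
  eqn : ∀ᵐ t ∂MeasureTheory.volume.restrict (Set.Icc 0 T),
    HasDerivAt γ (∑ i, u t i • X i (γ t)) t

/-- `p` can be reached from `q` by a trajectory of the control system that stays in `W`. -/
def JoinedBy {m : ℕ} (X : Fin m → E → E) (W : Set E) (q p : E) : Prop :=
  ∃ (T : ℝ) (u : ℝ → Fin m → ℝ) (γ : ℝ → E), 0 < T ∧ IsTrajectory X T u γ ∧
    γ 0 = q ∧ γ T = p ∧ ∀ t ∈ Set.Icc 0 T, γ t ∈ W

/-- Local controllability at `q`: inside every neighbourhood `W` of `q`, the point `q` can be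
joined to all points of a suitable neighbourhood of `q`. -/
def LocallyControllableAt {m : ℕ} (X : Fin m → E → E) (q : E) : Prop :=
  ∀ W ∈ 𝓝 q, ∃ V ∈ 𝓝 q, ∀ p ∈ V, JoinedBy X W q p

end Control

namespace Trident

/-- Configurations `(x, y, θ, φ, ℓ₁, ℓ₂, ℓ₃)`. -/
abbrev Config := Fin 7 → ℝ

/-- Configurations in which all legs have positive length. -/
def Admissible : Set Config := {q | 0 < q 4 ∧ 0 < q 5 ∧ 0 < q 6}

/-- Direction of the vertex of the root block that carries leg `i + 1`. -/
def vertexAngle (q : Config) : Fin 3 → ℝ :=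
  ![q 2 - 2 * Real.pi / 3, q 2, q 2 + 2 * Real.pi / 3]

/-- Direction of leg `i + 1`. -/
def legAngle (q : Config) : Fin 3 → ℝ :=
  ![q 2 - 2 * Real.pi / 3, q 2 + q 3, q 2 + 2 * Real.pi / 3]

/-- Length of leg `i + 1`. -/
def legLength (q : Config) : Fin 3 → ℝ := ![q 4, q 5, q 6]

/-- First coordinate of the `i + 1`-st wheel. -/
def wheelX (i : Fin 3) (q : Config) : ℝ :=
  q 0 + Real.cos (vertexAngle q i) + legLength q i * Real.cos (legAngle q i)

/-- Second coordinate of the `i + 1`-st wheel. -/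
def wheelY (i : Fin 3) (q : Config) : ℝ :=
  q 1 + Real.sin (vertexAngle q i) + legLength q i * Real.sin (legAngle q i)

/-- At the configuration `q` with velocity `v`, no wheel moves sideways, i.e. every wheel velocity
is orthogonal to the normal of its leg. -/
def NoSideSlip (q v : Config) : Prop :=
  ∀ i : Fin 3, -Real.sin (legAngle q i) * fderiv ℝ (wheelX i) q v +
    Real.cos (legAngle q i) * fderiv ℝ (wheelY i) q v = 0

/-- Coefficients of the three Pfaff forms with respect to `dx, dy, dθ, dφ, dℓ₁, dℓ₂, dℓ₃`. -/
def pfaff (q : Config) : Matrix (Fin 3) (Fin 7) ℝ :=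
  !![-Real.sin (q 2 - 2 * Real.pi / 3), Real.cos (q 2 - 2 * Real.pi / 3), 1 + q 4, 0, 0, 0, 0;
     -Real.sin (q 2 + q 3), Real.cos (q 2 + q 3), Real.cos (q 3) + q 5, q 5, 0, 0, 0;
     -Real.sin (q 2 + 2 * Real.pi / 3), Real.cos (q 2 + 2 * Real.pi / 3), 1 + q 6, 0, 0, 0, 0]

/-- The horizontal distribution: the solution space of the Pfaff system at `q`. -/
def horizontal (q : Config) : Submodule ℝ Config := LinearMap.ker (pfaff q).mulVecLin

/-- `L = ℓ₁ + ℓ₃ + 2`. -/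
def L (q : Config) : ℝ := q 4 + q 6 + 2

/-- The vector field `X₁`. -/
def X₁ (q : Config) : Config :=
  ![Real.sin (q 2) + (q 4 - q 6) * √3 / (3 * L q) * Real.cos (q 2),
    -Real.cos (q 2) + (q 4 - q 6) * √3 / (3 * L q) * Real.sin (q 2),
    -1 / L q,
    (Real.sin (q 3) * √3 * (q 4 - q 6) + 3 * Real.cos (q 3) * (L q + 1) + 3 * q 5) /
      (3 * q 5 * L q),
    0, 0, 0]

/-- The vector field `X₂ = ∂/∂ℓ₁`. -/
def X₂ (_ : Config) : Config := ![0, 0, 0, 0, 1, 0, 0]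

/-- The vector field `X₃ = ∂/∂ℓ₂`. -/
def X₃ (_ : Config) : Config := ![0, 0, 0, 0, 0, 1, 0]

/-- The vector field `X₄ = ∂/∂ℓ₃`. -/
def X₄ (_ : Config) : Config := ![0, 0, 0, 0, 0, 0, 1]

/-- The control vector fields `X₁, X₂, X₃, X₄`. -/
def frame : Fin 4 → Config → Config := ![X₁, X₂, X₃, X₄]

/-- `X₁₂ = [X₁, X₂]`. -/
def X₁₂ : Config → Config := VectorField.lieBracket ℝ X₁ X₂

/-- `X₁₃ = [X₁, X₃]`. -/
def X₁₃ : Config → Config := VectorField.lieBracket ℝ X₁ X₃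

/-- `X₁₄ = [X₁, X₄]`. -/
def X₁₄ : Config → Config := VectorField.lieBracket ℝ X₁ X₄

/-- The condition `sin φ (ℓ₁ - ℓ₃) + √3 cos φ (L + 1) ≠ 0`. -/
def Regular (q : Config) : Prop :=
  Real.sin (q 3) * (q 4 - q 6) + √3 * Real.cos (q 3) * (L q + 1) ≠ 0

end Trident

end

/-! The kinematic claims are linear algebra. The sum and difference of the two outer Pfaff equations
separate the components of the root velocity, and `X₂`, `X₃`, `X₄` are constant, so every bracket
with `X₁` is minus a directional derivative of `X₁`. The field `X₁₃` is a multiple of `∂φ` whose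
coefficient vanishes exactly when `q` is not regular; at a regular `q` the remaining directions are
peeled off one after another (`eq_top_of_regular`).

Controllability also covers singular configurations and is proved by hand. Extending or retracting
legs is a translation of `ℝ⁷` that the system can perform. Conjugating the flow of `X₁` by such a
translation `σ` moves points near `q` in direction `X₁ (q + σ)` (`HasLocalMotion.of_translate`). The
span of all directions available at `q` therefore contains the values of `X₁` on the nearby leg
translates of `q`, hence also its derivatives along the legs there, i.e. the brackets. Some
arbitrarily close translate is regular, so the span is everything. Composing finitely many motions
gives a map with surjective strict derivative, hence one onto a neighbourhood of `q`
(`exists_nhds_joinedBy`). Connectedness of `Ω` makes the result global. -/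

namespace Control

open Set Filter MeasureTheory

variable {E : Type*} [NormedAddCommGroup E] [NormedSpace ℝ E] {m : ℕ} {X : Fin m → E → E}
  {W : Set E} {q p r v : E}

/-! ### Operations on trajectories -/

section JoinedBy

/-- The constant curve is a trajectory. -/
lemma JoinedBy.refl (hq : q ∈ W) : JoinedBy X W q q := by
  refine ⟨1, fun _ _ => 0, fun _ => q, one_pos,
    ⟨measurable_const, ⟨0, fun _ => ?_⟩, ⟨0, ?_⟩, ?_⟩, rfl, rfl, fun _ _ => hq⟩
  · exact (norm_zero (E := Fin m → ℝ)).le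
  · exact (LipschitzWith.const q).lipschitzOnWith
  · refine Eventually.of_forall fun t => ?_
    simpa using hasDerivAt_const t q

/-- Trajectories can be run backwards. -/
lemma JoinedBy.symm (h : JoinedBy X W q p) : JoinedBy X W p q := by
  obtain ⟨T, u, γ, hT, ⟨hm, ⟨C, hC⟩, ⟨K, hK⟩, he⟩, h0, h1, hW⟩ := h
  have hmaps : ∀ t ∈ Icc 0 T, T - t ∈ Icc 0 T := fun t ht =>
    ⟨by linarith [ht.2], by linarith [ht.1]⟩
  refine ⟨T, fun t => -u (T - t), fun t => γ (T - t), hT, ⟨?_, ⟨C, ?_⟩, ⟨K, ?_⟩, ?_⟩,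
    by simpa using h1, by simpa using h0, fun t ht => hW _ (hmaps t ht)⟩
  · exact (hm.comp (measurable_const.sub measurable_id)).neg
  · intro t
    rw [norm_neg]
    exact hC _
  · refine LipschitzOnWith.of_dist_le_mul fun s hs t ht => ?_
    have := hK.dist_le_mul _ (hmaps s hs) _ (hmaps t ht)
    rwa [dist_sub_left] at this
  · rw [ae_restrict_iff' measurableSet_Icc] at he ⊢
    have := (volume.measurePreserving_sub_left T).quasiMeasurePreserving.ae he
    filter_upwards [this] with t ht hti
    have h2 := (ht (hmaps t hti)).scomp t ((hasDerivAt_id t).const_sub T)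
    simpa [Function.comp_def, Finset.sum_neg_distrib] using h2

/-- Trajectories can be concatenated. -/
lemma JoinedBy.trans (h : JoinedBy X W q p) (h' : JoinedBy X W p r) : JoinedBy X W q r := by
  obtain ⟨T, u, γ, hT, ⟨hm, ⟨C, hC⟩, ⟨K, hK⟩, he⟩, h0, h1, hW⟩ := h
  obtain ⟨T', u', γ', hT', ⟨hm', ⟨C', hC'⟩, ⟨K', hK'⟩, he'⟩, h0', h1', hW'⟩ := h'
  set g : ℝ → E := fun t => if t ≤ T then γ t else γ' (t - T) with hg
  have gl : ∀ t, t ≤ T → g t = γ t := fun t ht => if_pos ht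
  have gr : ∀ t, T ≤ t → g t = γ' (t - T) := fun t ht => by
    rcases ht.eq_or_lt with rfl | ht
    · rw [gl _ le_rfl, h1, sub_self, h0']
    · exact if_neg (not_le.2 ht)
  have hl : LipschitzOnWith K g (Icc 0 T) := fun s hs t ht => by
    rw [gl s hs.2, gl t ht.2]
    exact hK hs ht
  have hr : ∀ s ∈ Icc T (T + T'), ∀ t ∈ Icc T (T + T'), dist (g s) (g t) ≤ K' * dist s t :=
      fun s hs t ht => by
    rw [gr s hs.1, gr t ht.1, ← dist_sub_right s t T]
    exact hK'.dist_le_mul _ ⟨by linarith [hs.1], by linarith [hs.2]⟩ _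
      ⟨by linarith [ht.1], by linarith [ht.2]⟩
  -- If `T` separates `s` and `t`, their distances to `T` add up to `dist s t`, so passing through
  -- the junction keeps the constant `max K K'`.
  have hmono : ∀ s ∈ Icc 0 (T + T'), ∀ t ∈ Icc 0 (T + T'), s ≤ t →
      dist (g s) (g t) ≤ (max K K' : NNReal) * dist s t := by
    intro s hs t ht hst
    have hKm : (K : ℝ) ≤ (max K K' : NNReal) := NNReal.coe_le_coe.2 (le_max_left _ _)
    have hKm' : (K' : ℝ) ≤ (max K K' : NNReal) := NNReal.coe_le_coe.2 (le_max_right _ _)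
    rcases le_total t T with htT | htT
    · exact (hl.dist_le_mul s ⟨hs.1, hst.trans htT⟩ t ⟨ht.1, htT⟩).trans (by gcongr)
    rcases le_total T s with hsT | hsT
    · exact (hr s ⟨hsT, hs.2⟩ t ⟨htT, ht.2⟩).trans (by gcongr)
    · calc dist (g s) (g t) ≤ dist (g s) (g T) + dist (g T) (g t) := dist_triangle _ _ _
        _ ≤ K * dist s T + K' * dist T t :=
          add_le_add (hl.dist_le_mul s ⟨hs.1, hsT⟩ T ⟨hT.le, le_rfl⟩)
            (hr T ⟨le_rfl, by linarith⟩ t ⟨htT, ht.2⟩)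
        _ ≤ (max K K' : NNReal) * dist s T + (max K K' : NNReal) * dist T t := by gcongr
        _ = (max K K' : NNReal) * dist s t := by
          simp only [Real.dist_eq, abs_of_nonpos (sub_nonpos.2 hsT),
            abs_of_nonpos (sub_nonpos.2 htT), abs_of_nonpos (sub_nonpos.2 hst)]
          ring
  refine ⟨T + T', fun t => if t ≤ T then u t else u' (t - T), g, by linarith,
    ⟨?_, ⟨max C C', fun t => ?_⟩, ⟨max K K', ?_⟩, ?_⟩, ?_, ?_, ?_⟩
  · exact Measurable.ite measurableSet_Iic hm (hm'.comp (measurable_id.sub_const T))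
  · split_ifs
    · exact (hC t).trans (le_max_left _ _)
    · exact (hC' _).trans (le_max_right _ _)
  · refine LipschitzOnWith.of_dist_le_mul fun s hs t ht => ?_
    rcases le_total s t with hst | hst
    · exact hmono s hs t ht hst
    · rw [dist_comm (g s), dist_comm s]
      exact hmono t ht s hs hst
  · rw [ae_restrict_iff' measurableSet_Icc] at he he' ⊢
    have hshift := (measurePreserving_sub_right volume T).quasiMeasurePreserving.ae he'
    -- The one-sided derivatives may differ at the junction, which is a null set.
    have hne : ∀ᵐ t : ℝ, t ≠ T := (measure_eq_zero_iff_ae_notMem.1 (measure_singleton T))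
    filter_upwards [he, hshift, hne] with t h1 h2 h3 hti
    rcases lt_or_gt_of_ne h3 with hlt | hlt
    · rw [gl t hlt.le]
      simp only [hlt.le, if_true]
      refine (h1 ⟨hti.1, hlt.le⟩).congr_of_eventuallyEq ?_
      filter_upwards [Iio_mem_nhds hlt] with s hs using gl s (le_of_lt hs)
    · rw [gr t hlt.le]
      simp only [not_le.2 hlt, if_false]
      have h4 := (h2 ⟨by linarith, by linarith [hti.2]⟩).comp_sub_const t T
      refine h4.congr_of_eventuallyEq ?_
      filter_upwards [Ioi_mem_nhds hlt] with s hs using gr s (le_of_lt hs)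
  · rw [gl 0 hT.le, h0]
  · rw [gr _ (by linarith), add_sub_cancel_left, h1']
  · intro t ht
    rcases le_total t T with htT | htT
    · rw [gl t htT]
      exact hW t ⟨ht.1, htT⟩
    · rw [gr t htT]
      exact hW' _ ⟨by linarith, by linarith [ht.2]⟩

lemma JoinedBy.mono {W' : Set E} (hWW : W ⊆ W') (h : JoinedBy X W q p) : JoinedBy X W' q p := by
  obtain ⟨T, u, γ, hT, hγ, h0, h1, hW⟩ := h
  exact ⟨T, u, γ, hT, hγ, h0, h1, fun t ht => hWW (hW t ht)⟩

/-- Integral curves of constant combinations of the control fields are trajectories. -/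
lemma JoinedBy.of_hasDerivAt (hX : ∀ i, ContinuousOn (X i) W) (u : Fin m → ℝ) {γ : ℝ → E}
    (hγ : ∀ t ∈ Icc (0 : ℝ) 1, HasDerivAt γ (∑ i, u i • X i (γ t)) t)
    (hW : ∀ t ∈ Icc (0 : ℝ) 1, γ t ∈ W) : JoinedBy X W (γ 0) (γ 1) := by
  have hc : ContinuousOn γ (Icc 0 1) := fun t ht => (hγ t ht).continuousAt.continuousWithinAt
  have hd : ContinuousOn (fun t => ∑ i, u i • X i (γ t)) (Icc 0 1) :=
    continuousOn_finsetSum _ fun i _ => ((hX i).comp hc hW).const_smul (u i)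
  obtain ⟨C, hC⟩ := isCompact_Icc.exists_bound_of_continuousOn hd
  refine ⟨1, fun _ => u, γ, one_pos, ⟨measurable_const, ⟨‖u‖, fun _ => le_rfl⟩,
    ⟨C.toNNReal, ?_⟩, ?_⟩, rfl, rfl, hW⟩
  · refine (convex_Icc (0 : ℝ) 1).lipschitzOnWith_of_nnnorm_hasDerivWithin_le
      (fun t ht => (hγ t ht).hasDerivWithinAt) fun t ht => ?_
    rw [← norm_toNNReal]
    exact Real.toNNReal_le_toNNReal (hC t ht)
  · rw [ae_restrict_iff' measurableSet_Icc]
    exact Eventually.of_forall hγ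

end JoinedBy

/-! ### Local flows -/

/-- A `C¹` vector field has a local flow that is strictly differentiable at time `0`. -/
lemma exists_localFlow [CompleteSpace E] {f : E → E} (hf : ContDiffAt ℝ 1 f q) :
    ∃ Φ : ℝ × E → E, (∀ᶠ x in 𝓝 q, Φ (0, x) = x) ∧
      HasStrictFDerivAt Φ ((ContinuousLinearMap.fst ℝ ℝ E).smulRight (f q) +
        ContinuousLinearMap.snd ℝ ℝ E) (0, q) ∧
      ∀ᶠ z in 𝓝 ((0 : ℝ), q), HasDerivAt (fun t => Φ (t, z.2)) (f (Φ z)) z.1 := by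
  obtain ⟨ε, hε, a, ρ, B, K, hρ, hpl⟩ := IsPicardLindelof.of_contDiffAt_one hf
  obtain ⟨α, hα, L', hL'⟩ :=
    (hpl 0).exists_forall_mem_closedBall_eq_hasDerivWithinAt_lipschitzOnWith
  simp only [zero_sub, zero_add] at hα hL'
  have hρ' : (0 : ℝ) < ρ := hρ
  have hα0 : ∀ x ∈ Metric.closedBall q (ρ : ℝ), α x 0 = x := fun x hx => (hα x hx).1
  have hder : ∀ x ∈ Metric.closedBall q (ρ : ℝ), ∀ t ∈ Ioo (-ε) ε,
      HasDerivAt (α x) (f (α x t)) t := fun x hx t ht =>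
    ((hα x hx).2 t (Ioo_subset_Icc_self ht)).hasDerivAt (Icc_mem_nhds ht.1 ht.2)
  have hqb : q ∈ Metric.closedBall q (ρ : ℝ) := Metric.mem_closedBall_self hρ'.le
  have hcont : ContinuousAt (fun z : ℝ × E => α z.2 z.1) (0, q) := by
    have h1 : ContinuousOn (Function.uncurry α) (Metric.closedBall q (ρ : ℝ) ×ˢ Icc (-ε) ε) :=
      continuousOn_prod_of_continuousOn_lipschitzOnWith _ L'
        (fun x hx => HasDerivWithinAt.continuousOn (hα x hx).2) hL'
    have h2 : ContinuousAt (Function.uncurry α) (q, 0) := h1.continuousAt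
      (prod_mem_nhds (Metric.closedBall_mem_nhds q hρ') (Icc_mem_nhds (by linarith) hε))
    exact h2.comp_of_eq (f := Prod.swap) continuous_swap.continuousAt rfl
  have hval : α q 0 = q := hα0 q hqb
  refine ⟨fun z => α z.2 z.1, ?_, ?_, ?_⟩
  · filter_upwards [Metric.closedBall_mem_nhds q hρ'] with x hx using hα0 x hx
  · rw [hasStrictFDerivAt_iff_isLittleO, Asymptotics.isLittleO_iff]
    intro c hc
    obtain ⟨KL, s, hs, hlip⟩ := hf.exists_lipschitzOnWith
    have hfc : ContinuousAt (fun z : ℝ × E => f (α z.2 z.1)) (0, q) :=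
      ContinuousAt.comp_of_eq hf.continuousAt hcont hval
    have e1 : ∀ᶠ z in 𝓝 ((0 : ℝ), q), ‖f (α z.2 z.1) - f q‖ < c / 2 := by
      have := Metric.tendsto_nhds.1 hfc (c / 2) (half_pos hc)
      simpa [hval, dist_eq_norm] using this
    have e2 : ∀ᶠ z in 𝓝 ((0 : ℝ), q), α z.2 z.1 ∈ s :=
      hcont.eventually (by simpa [hval] using hs)
    have e3 : ∀ᶠ z in 𝓝 ((0 : ℝ), q), z.2 ∈ Metric.closedBall q (ρ : ℝ) :=
      continuousAt_snd.eventually (Metric.closedBall_mem_nhds q hρ')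
    have e4 : ∀ᶠ z in 𝓝 ((0 : ℝ), q), z.1 ∈ Ioo (-ε) ε :=
      continuousAt_fst.eventually (Ioo_mem_nhds (neg_lt_zero.2 hε) hε)
    have e5 : ∀ᶠ z in 𝓝 ((0 : ℝ), q), KL * L' * |z.1| < c / 2 := by
      have h1 : ContinuousAt (fun z : ℝ × E => (KL * L' * |z.1| : ℝ)) (0, q) := by fun_prop
      exact h1.eventually_lt continuousAt_const (by simpa using hc)
    obtain ⟨δ, hδ, hball⟩ := Metric.eventually_nhds_iff_ball.1 (e1.and (e2.and (e3.and (e4.and e5))))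
    rw [← ball_prod_same] at hball
    have hI : Convex ℝ (Metric.ball (0 : ℝ) δ) := convex_ball _ _
    filter_upwards [prod_mem_nhds (Metric.ball_mem_nhds ((0 : ℝ), q) hδ)
      (Metric.ball_mem_nhds ((0 : ℝ), q) hδ)] with z hz
    obtain ⟨⟨t, x⟩, ⟨s', y⟩⟩ := z
    rw [← ball_prod_same] at hz
    obtain ⟨⟨ht, hx⟩, hs', hy⟩ := hz
    dsimp only at ht hx hs' hy ⊢
    -- First half of the increment: time changes along the orbit of `x`. The velocity stays within
    -- `c / 2` of `f q` by continuity.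
    have b1 : ‖(α x t - t • f q) - (α x s' - s' • f q)‖ ≤ c / 2 * ‖t - s'‖ := by
      refine hI.norm_image_sub_le_of_norm_hasDerivWithin_le
        (f := fun τ => α x τ - τ • f q) (f' := fun τ => f (α x τ) - (1 : ℝ) • f q)
        (fun τ hτ => ?_) (fun τ hτ => ?_) hs' ht
      · obtain ⟨-, -, h3, h4, -⟩ := hball (τ, x) ⟨hτ, hx⟩
        exact ((hder x h3 τ h4).sub ((hasDerivAt_id τ).smul_const (f q))).hasDerivWithinAt
      · rw [one_smul]
        exact (hball (τ, x) ⟨hτ, hx⟩).1.le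
    -- Second half: the starting point changes at fixed time. The Lipschitz bounds on `f` and on the
    -- flow limit the drift to `KL * L' * |s'| * ‖x - y‖`, and `δ` was chosen to make the factor
    -- less than `c / 2`.
    have b2 : ‖(α x s' - α y s') - (α x 0 - α y 0)‖ ≤ KL * (L' * ‖x - y‖) * ‖s' - 0‖ := by
      refine hI.norm_image_sub_le_of_norm_hasDerivWithin_le
        (f := fun τ => α x τ - α y τ) (f' := fun τ => f (α x τ) - f (α y τ))
        (fun τ hτ => ?_) (fun τ hτ => ?_) (Metric.mem_ball_self hδ) hs'
      · obtain ⟨-, -, h3, h4, -⟩ := hball (τ, x) ⟨hτ, hx⟩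
        obtain ⟨-, -, h3', -, -⟩ := hball (τ, y) ⟨hτ, hy⟩
        exact ((hder x h3 τ h4).sub (hder y h3' τ h4)).hasDerivWithinAt
      · obtain ⟨-, h2, h3, h4, -⟩ := hball (τ, x) ⟨hτ, hx⟩
        obtain ⟨-, h2', h3', -, -⟩ := hball (τ, y) ⟨hτ, hy⟩
        refine (hlip.norm_sub_le h2 h2').trans ?_
        gcongr
        exact (hL' τ (Ioo_subset_Icc_self h4)).norm_sub_le h3 h3'
    obtain ⟨-, -, h3, -, h5⟩ := hball (s', x) ⟨hs', hx⟩
    obtain ⟨-, -, h3', -, -⟩ := hball (s', y) ⟨hs', hy⟩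
    rw [hα0 x h3, hα0 y h3', sub_zero] at b2
    have b2' : ‖(α x s' - α y s') - (x - y)‖ ≤ c / 2 * ‖x - y‖ := by
      refine b2.trans ?_
      rw [Real.norm_eq_abs]
      calc KL * (L' * ‖x - y‖) * |s'| = KL * L' * |s'| * ‖x - y‖ := by ring
        _ ≤ c / 2 * ‖x - y‖ := by
          gcongr
    have hsplit : α x t - α y s' - ((ContinuousLinearMap.fst ℝ ℝ E).smulRight (f q) +
        ContinuousLinearMap.snd ℝ ℝ E) ((t, x) - (s', y)) =
        ((α x t - t • f q) - (α x s' - s' • f q)) + ((α x s' - α y s') - (x - y)) := by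
      simp only [Prod.mk_sub_mk, add_apply,
        ContinuousLinearMap.smulRight_apply, ContinuousLinearMap.coe_fst',
        ContinuousLinearMap.coe_snd', sub_smul]
      abel
    rw [hsplit]
    calc _ ≤ c / 2 * ‖t - s'‖ + c / 2 * ‖x - y‖ := norm_add_le_of_le b1 b2'
      _ ≤ c / 2 * ‖(t, x) - (s', y)‖ + c / 2 * ‖(t, x) - (s', y)‖ := by
        gcongr
        · exact norm_fst_le ((t, x) - (s', y))
        · exact norm_snd_le ((t, x) - (s', y))
      _ = c * ‖(t, x) - (s', y)‖ := by ring
  · filter_upwards [continuousAt_snd.eventually (Metric.closedBall_mem_nhds q hρ'),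
      continuousAt_fst.eventually (Ioo_mem_nhds (neg_lt_zero.2 hε) hε)] with z h1 h2
    exact hder z.2 h1 z.1 h2

/-! ### Local motions and reachable neighbourhoods -/

/-- The control system can move points near `q`, within `W`, in the direction `v`: there is a family
of motions, joining every point to its image, that is strictly differentiable at time `0`. -/
def HasLocalMotion (X : Fin m → E → E) (W : Set E) (q v : E) : Prop :=
  ∃ Ψ : ℝ × E → E, Ψ (0, q) = q ∧
    HasStrictFDerivAt Ψ ((ContinuousLinearMap.fst ℝ ℝ E).smulRight v +
      ContinuousLinearMap.snd ℝ ℝ E) (0, q) ∧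
    ∀ᶠ z in 𝓝 ((0 : ℝ), q), JoinedBy X W z.2 (Ψ z)

/-- The system can move in the direction of each of its control fields. -/
lemma hasLocalMotion_field [CompleteSpace E] (hX : ∀ i, ContinuousOn (X i) W) (hW : W ∈ 𝓝 q)
    (i : Fin m) (hi : ContDiffAt ℝ 1 (X i) q) : HasLocalMotion X W q (X i q) := by
  obtain ⟨Φ, h0, hd, he⟩ := exists_localFlow hi
  refine ⟨Φ, h0.self_of_nhds, hd, ?_⟩
  have hΦW : ∀ᶠ z in 𝓝 ((0 : ℝ), q), Φ z ∈ W :=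
    hd.continuousAt.eventually (by simpa [h0.self_of_nhds] using hW)
  obtain ⟨δ, hδ, hball⟩ := Metric.eventually_nhds_iff_ball.1 (he.and hΦW)
  filter_upwards [Metric.ball_mem_nhds ((0 : ℝ), q) hδ, continuousAt_snd.eventually h0]
    with ⟨t, x⟩ hz hx0
  rw [← ball_prod_same] at hz hball
  obtain ⟨ht, hx⟩ := hz
  dsimp only at ht hx hx0 ⊢
  have hmem : ∀ τ ∈ Icc (0 : ℝ) 1, (τ * t, x) ∈ Metric.ball (0 : ℝ) δ ×ˢ Metric.ball q δ := by
    refine fun τ hτ => ⟨?_, hx⟩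
    rw [mem_ball_zero_iff] at ht ⊢
    rw [norm_mul, Real.norm_of_nonneg hτ.1]
    exact (mul_le_of_le_one_left (norm_nonneg t) hτ.2).trans_lt ht
  -- The flow for time `t` is run in unit time with constant control `t`, which also handles `t ≤
  -- 0`.
  have := JoinedBy.of_hasDerivAt (γ := fun τ => Φ (τ * t, x)) hX (Pi.single i t)
    (fun τ hτ => ?_) fun τ hτ => (hball _ (hmem τ hτ)).2
  · simpa [hx0] using this
  · have h1 := (hball _ (hmem τ hτ)).1
    have h2 := h1.scomp τ ((hasDerivAt_id τ).mul_const t)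
    rw [Finset.sum_eq_single i (fun j _ hj => by simp [hj]) (by simp)]
    simpa [Function.comp_def] using h2

/-- Motions can be conjugated by a translation that the system can perform. -/
lemma HasLocalMotion.of_translate {σ : E} (hσ : ∀ᶠ x in 𝓝 q, JoinedBy X W x (x + σ))
    (h : HasLocalMotion X W (q + σ) v) : HasLocalMotion X W q v := by
  obtain ⟨Φ, h0, hd, he⟩ := h
  have hs : HasStrictFDerivAt (fun z : ℝ × E => (z.1, z.2 + σ)) (ContinuousLinearMap.id ℝ (ℝ × E))
      (0, q) :=
    (ContinuousLinearMap.fst ℝ ℝ E).hasStrictFDerivAt.prodMk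
      ((ContinuousLinearMap.snd ℝ ℝ E).hasStrictFDerivAt.add_const σ)
  have hd' : HasStrictFDerivAt (fun z : ℝ × E => Φ (z.1, z.2 + σ) - σ)
      ((ContinuousLinearMap.fst ℝ ℝ E).smulRight v + ContinuousLinearMap.snd ℝ ℝ E) (0, q) :=
    (HasStrictFDerivAt.comp (f := fun z : ℝ × E => (z.1, z.2 + σ)) (0, q) hd hs).sub_const σ
  have hval : Φ (0, q + σ) - σ = q := by rw [h0, add_sub_cancel_right]
  refine ⟨fun z => Φ (z.1, z.2 + σ) - σ, hval, hd', ?_⟩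
  -- Translate by `σ`, follow `Φ`, then reverse the translation that ends at the point reached.
  filter_upwards [continuousAt_snd.eventually hσ, hs.continuousAt.eventually he,
    hd'.continuousAt.eventually (by simpa only [hval] using hσ)] with z h1 h2 h3
  rw [sub_add_cancel] at h3
  exact (h1.trans h2).trans h3.symm

/-- If the system can move in a spanning set of directions at `q`, it reaches a neighbourhood
of `q`. -/
lemma exists_nhds_joinedBy [FiniteDimensional ℝ E] (hq : q ∈ W)
    (hspan : Submodule.span ℝ {v | HasLocalMotion X W q v} = ⊤) :
    ∃ V ∈ 𝓝 q, ∀ p ∈ V, JoinedBy X W q p := by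
  have : CompleteSpace E := FiniteDimensional.complete ℝ E
  -- One time parameter per direction: each induction step applies a further motion `Ψ` to the
  -- endpoint of the earlier ones, which adds `v` to the range of the derivative at `0`.
  have key : ∀ S : Finset E, (S : Set E) ⊆ {v | HasLocalMotion X W q v} →
      ∃ (n : ℕ) (F : (Fin n → ℝ) → E) (F' : (Fin n → ℝ) →L[ℝ] E), F 0 = q ∧
        HasStrictFDerivAt F F' 0 ∧ (∀ᶠ s in 𝓝 0, JoinedBy X W q (F s)) ∧
        Submodule.span ℝ (S : Set E) ≤ F'.range := by
    classical
    intro S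
    induction S using Finset.induction_on with
    | empty =>
      intro _
      exact ⟨0, fun _ => q, 0, rfl, hasStrictFDerivAt_const q 0,
        Eventually.of_forall fun _ => JoinedBy.refl hq, by simp⟩
    | insert v S _ ih =>
      intro hS
      rw [Finset.coe_insert, insert_subset_iff] at hS
      obtain ⟨n, F, F', hF0, hF, hFj, hr⟩ := ih hS.2
      obtain ⟨Ψ, hΨ0, hΨ, hΨj⟩ := hS.1
      let hd : (Fin (n + 1) → ℝ) →L[ℝ] ℝ := ContinuousLinearMap.proj 0
      let tl : (Fin (n + 1) → ℝ) →L[ℝ] (Fin n → ℝ) :=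
        ContinuousLinearMap.pi fun i => ContinuousLinearMap.proj i.succ
      have htl : HasStrictFDerivAt (fun s => F (tl s)) (F'.comp tl) 0 :=
        HasStrictFDerivAt.comp (f := tl) 0 (by simpa using hF) tl.hasStrictFDerivAt
      have hpair : HasStrictFDerivAt (fun s => (hd s, F (tl s))) (hd.prod (F'.comp tl)) 0 :=
        hd.hasStrictFDerivAt.prodMk htl
      have hpair0 : (hd 0, F (tl 0)) = (0, q) := by rw [map_zero, map_zero, hF0]
      refine ⟨n + 1, fun s => Ψ (hd s, F (tl s)), _, ?_,
        HasStrictFDerivAt.comp (f := fun s => (hd s, F (tl s))) 0 (hpair0 ▸ hΨ) hpair, ?_, ?_⟩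
      · simpa only [hpair0] using hΨ0
      · have h1 : ∀ᶠ s in 𝓝 0, JoinedBy X W q (F (tl s)) :=
          tl.continuous.continuousAt.eventually (p := fun w => JoinedBy X W q (F w))
            (by simpa using hFj)
        have h2 := hpair.continuousAt.eventually (p := fun z => JoinedBy X W z.2 (Ψ z))
          (by simpa only [hpair0] using hΨj)
        filter_upwards [h1, h2] with s h1 h2 using h1.trans h2
      · rw [Finset.coe_insert, Submodule.span_insert, sup_le_iff, Submodule.span_singleton_le_iff_mem]
        have hcons : ∀ (t : ℝ) (w : Fin n → ℝ), hd (Fin.cons t w) = t ∧ tl (Fin.cons t w) = w :=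
          fun t w => ⟨rfl, rfl⟩
        refine ⟨⟨Fin.cons 1 0, ?_⟩, fun w hw => ?_⟩
        · simp [hcons]
        · obtain ⟨y, rfl⟩ := hr hw
          refine ⟨Fin.cons 0 y, ?_⟩
          simp [hcons]
  obtain ⟨S, hS, hSspan⟩ := (Submodule.fg_span_iff_fg_span_finset_subset
    {v | HasLocalMotion X W q v}).1 (hspan ▸ Module.Finite.fg_top)
  obtain ⟨n, F, F', hF0, hF, hFj, hr⟩ := key S hS
  have hsurj : F'.range = ⊤ := top_unique (hspan ▸ hSspan ▸ hr)
  refine ⟨F '' {s | JoinedBy X W q (F s)}, ?_, ?_⟩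
  · have hmap := hF.map_nhds_eq_of_surj hsurj
    rw [hF0] at hmap
    exact hmap ▸ image_mem_map hFj
  · rintro _ ⟨s, hs, rfl⟩
    exact hs

/-- Local controllability at all points of an open connected set implies that any two of its points
can be joined within it. -/
lemma joinedBy_of_isPreconnected {Ω : Set E} (hΩ : IsOpen Ω) (hc : IsPreconnected Ω)
    (h : ∀ q ∈ Ω, LocallyControllableAt X q) (hq : q ∈ Ω) (hp : p ∈ Ω) : JoinedBy X Ω q p := by
  refine hc.induction₂ (JoinedBy X Ω) (fun x hx => ?_) (fun _ _ _ _ _ _ => JoinedBy.trans)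
    (fun _ _ _ _ => JoinedBy.symm) hq hp
  obtain ⟨V, hV, hVj⟩ := h x hx Ω (hΩ.mem_nhds hx)
  exact mem_nhdsWithin_of_mem_nhds (mem_of_superset hV hVj)

end Control

namespace Trident

open Set Filter Control

/-! ### Trigonometric constants -/

section Trigonometry

lemma sin_two_pi_div_three : Real.sin (2 * Real.pi / 3) = √3 / 2 := by
  rw [← Real.sin_pi_div_three, ← Real.sin_pi_sub (Real.pi / 3)]
  ring_nf

lemma cos_two_pi_div_three : Real.cos (2 * Real.pi / 3) = -(1 / 2) := by
  rw [← Real.cos_pi_div_three, ← Real.cos_pi_sub (Real.pi / 3)]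
  ring_nf

lemma sqrt_three_sq : √(3 : ℝ) ^ 2 = 3 := Real.sq_sqrt (by norm_num)

end Trigonometry

/-! ### The Pfaff system and the no-slip condition -/

section Pfaff

lemma mem_horizontal_iff (q v : Config) : v ∈ horizontal q ↔
    (-Real.sin (q 2 - 2 * Real.pi / 3) * v 0 + Real.cos (q 2 - 2 * Real.pi / 3) * v 1
        + (1 + q 4) * v 2 = 0) ∧
      (-Real.sin (q 2 + q 3) * v 0 + Real.cos (q 2 + q 3) * v 1 + (Real.cos (q 3) + q 5) * v 2
        + q 5 * v 3 = 0) ∧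
      -Real.sin (q 2 + 2 * Real.pi / 3) * v 0 + Real.cos (q 2 + 2 * Real.pi / 3) * v 1
        + (1 + q 6) * v 2 = 0 := by
  rw [horizontal, LinearMap.mem_ker, Matrix.mulVecLin_apply, funext_iff]
  simp [pfaff, Matrix.mulVec, dotProduct, Fin.forall_fin_succ, Fin.sum_univ_succ, add_assoc]

/-- The Pfaff system in the moving frame of the root block. -/
lemma mem_horizontal_iff' (q v : Config) : v ∈ horizontal q ↔
    Real.sin (q 2) * v 0 - Real.cos (q 2) * v 1 = -L q * v 2 ∧
      Real.cos (q 2) * v 0 + Real.sin (q 2) * v 1 = -((q 4 - q 6) * √3 / 3) * v 2 ∧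
      q 5 * v 3 = -(Real.sin (q 3) * ((q 4 - q 6) * √3 / 3) + Real.cos (q 3) * (L q + 1) + q 5)
        * v 2 := by
  rw [mem_horizontal_iff]
  simp only [Real.sin_sub, Real.cos_sub, Real.sin_add, Real.cos_add, sin_two_pi_div_three,
    cos_two_pi_div_three, L]
  have h3 := sqrt_three_sq
  constructor
  · rintro ⟨h1, h2, h4⟩
    -- Adding the outer equations isolates the component of the root velocity along `(sin θ, -cos
    -- θ)`; their difference, next, isolates the one along `(cos θ, sin θ)`.
    have e1 : Real.sin (q 2) * v 0 - Real.cos (q 2) * v 1 = -(q 4 + q 6 + 2) * v 2 := by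
      linear_combination h1 + h4
    have e2 : Real.cos (q 2) * v 0 + Real.sin (q 2) * v 1 = -((q 4 - q 6) * √3 / 3) * v 2 := by
      linear_combination (√3 / 3) * h1 - (√3 / 3) * h4
        - (Real.cos (q 2) * v 0 + Real.sin (q 2) * v 1) / 3 * h3
    refine ⟨e1, e2, ?_⟩
    linear_combination h2 + Real.sin (q 3) * e2 + Real.cos (q 3) * e1
  · rintro ⟨e1, e2, e3⟩
    refine ⟨?_, ?_, ?_⟩
    · linear_combination e1 / 2 + √3 / 2 * e2 - (q 4 - q 6) * v 2 / 6 * h3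
    · linear_combination e3 - Real.sin (q 3) * e2 - Real.cos (q 3) * e1
    · linear_combination e1 / 2 - √3 / 2 * e2 + (q 4 - q 6) * v 2 / 6 * h3

lemma fderiv_add_cos_add_mul_cos {a α β l : Config → ℝ} {a' α' β' l' : Config →L[ℝ] ℝ} {q : Config}
    (ha : HasFDerivAt a a' q) (hα : HasFDerivAt α α' q) (hβ : HasFDerivAt β β' q)
    (hl : HasFDerivAt l l' q) (v : Config) :
    fderiv ℝ (fun q => a q + Real.cos (α q) + l q * Real.cos (β q)) q v =
      a' v - Real.sin (α q) * α' v + (l' v * Real.cos (β q) - l q * Real.sin (β q) * β' v) := by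
  have h := ((ha.add hα.cos).add (hl.mul hβ.cos)).fderiv
  refine (congrArg (fun f : Config →L[ℝ] ℝ => f v) h).trans ?_
  simp
  ring

lemma fderiv_add_sin_add_mul_sin {a α β l : Config → ℝ} {a' α' β' l' : Config →L[ℝ] ℝ} {q : Config}
    (ha : HasFDerivAt a a' q) (hα : HasFDerivAt α α' q) (hβ : HasFDerivAt β β' q)
    (hl : HasFDerivAt l l' q) (v : Config) :
    fderiv ℝ (fun q => a q + Real.sin (α q) + l q * Real.sin (β q)) q v =
      a' v + Real.cos (α q) * α' v + (l' v * Real.sin (β q) + l q * Real.cos (β q) * β' v) := by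
  have h := ((ha.add hα.sin).add (hl.mul hβ.sin)).fderiv
  refine (congrArg (fun f : Config →L[ℝ] ℝ => f v) h).trans ?_
  simp
  ring

lemma hasFDerivAt_coord (i : Fin 7) (q : Config) :
    HasFDerivAt (fun q : Config => q i) (ContinuousLinearMap.proj (R := ℝ) i) q :=
  (ContinuousLinearMap.proj (R := ℝ) (φ := fun _ : Fin 7 => ℝ) i).hasFDerivAt

/-- The leg extension rate drops out because it acts along the leg, orthogonally to the normal. The
rest is `sin² + cos² = 1` at each wheel, and for the middle wheel also `cos (γ₂ - β₂) = cos φ`. -/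
lemma mem_horizontal_iff_noSideSlip (q v : Config) : v ∈ horizontal q ↔ NoSideSlip q v := by
  have d := fun i => hasFDerivAt_coord i q
  have hx0 := fderiv_add_cos_add_mul_cos (d 0) ((d 2).sub_const (2 * Real.pi / 3))
    ((d 2).sub_const (2 * Real.pi / 3)) (d 4) v
  have hy0 := fderiv_add_sin_add_mul_sin (d 1) ((d 2).sub_const (2 * Real.pi / 3))
    ((d 2).sub_const (2 * Real.pi / 3)) (d 4) v
  have hx1 := fderiv_add_cos_add_mul_cos (d 0) (d 2) ((d 2).add (d 3)) (d 5) v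
  have hy1 := fderiv_add_sin_add_mul_sin (d 1) (d 2) ((d 2).add (d 3)) (d 5) v
  have hx2 := fderiv_add_cos_add_mul_cos (d 0) ((d 2).add_const (2 * Real.pi / 3))
    ((d 2).add_const (2 * Real.pi / 3)) (d 6) v
  have hy2 := fderiv_add_sin_add_mul_sin (d 1) ((d 2).add_const (2 * Real.pi / 3))
    ((d 2).add_const (2 * Real.pi / 3)) (d 6) v
  rw [mem_horizontal_iff, NoSideSlip, Fin.forall_fin_succ, Fin.forall_fin_two]
  have ex0 : fderiv ℝ (wheelX 0) q v = _ := hx0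
  have ey0 : fderiv ℝ (wheelY 0) q v = _ := hy0
  have ex1 : fderiv ℝ (wheelX 1) q v = _ := hx1
  have ey1 : fderiv ℝ (wheelY 1) q v = _ := hy1
  have ex2 : fderiv ℝ (wheelX 2) q v = _ := hx2
  have ey2 : fderiv ℝ (wheelY 2) q v = _ := hy2
  have s1 : Fin.succ (0 : Fin 2) = 1 := rfl
  have s2 : Fin.succ (1 : Fin 2) = 2 := rfl
  have l0 : legAngle q 0 = q 2 - 2 * Real.pi / 3 := rfl
  have l1 : legAngle q 1 = q 2 + q 3 := rfl
  have l2 : legAngle q 2 = q 2 + 2 * Real.pi / 3 := rfl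
  rw [s1, s2, ex0, ey0, ex1, ey1, ex2, ey2, l0, l1, l2]
  simp only [ContinuousLinearMap.proj_apply, add_apply, Pi.add_apply]
  have t0 := Real.sin_sq_add_cos_sq (q 2 - 2 * Real.pi / 3)
  have t1 := Real.sin_sq_add_cos_sq (q 2 + q 3)
  have t2 := Real.sin_sq_add_cos_sq (q 2 + 2 * Real.pi / 3)
  have t3 : Real.sin (q 2 + q 3) * Real.sin (q 2) + Real.cos (q 2 + q 3) * Real.cos (q 2) =
      Real.cos (q 3) := by
    have := Real.cos_sub (q 2 + q 3) (q 2)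
    rw [add_sub_cancel_left] at this
    rw [this]
    ring
  refine and_congr ?_ (and_congr ?_ ?_)
  · refine Eq.congr_left ?_
    linear_combination (-v 2 - q 4 * v 2) * t0
  · refine Eq.congr_left ?_
    linear_combination (-(q 5) * (v 2 + v 3)) * t1 - v 2 * t3
  · refine Eq.congr_left ?_
    linear_combination (-v 2 - q 6 * v 2) * t2

end Pfaff

/-! ### Smoothness of the frame and the basis property -/

section Frame

variable {q : Config}

lemma L_pos (hq : q ∈ Admissible) : 0 < L q := by
  have := hq.1
  have := hq.2.2
  unfold L
  linarith

lemma isOpen_admissible : IsOpen Admissible :=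
  (isOpen_lt continuous_const (continuous_apply 4)).inter
    ((isOpen_lt continuous_const (continuous_apply 5)).inter
      (isOpen_lt continuous_const (continuous_apply 6)))

lemma convex_admissible : Convex ℝ Admissible := by
  rintro x ⟨hx1, hx2, hx3⟩ y ⟨hy1, hy2, hy3⟩ a b ha hb hab
  have key : ∀ i, 0 < x i → 0 < y i → 0 < (a • x + b • y) i := fun i h h' =>
    convex_Ioi (0 : ℝ) h h' ha hb hab
  exact ⟨key 4 hx1 hy1, key 5 hx2 hy2, key 6 hx3 hy3⟩

lemma contDiffAt_X₁ (hq : q ∈ Admissible) : ContDiffAt ℝ ∞ X₁ q := by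
  have hL := (L_pos hq).ne'
  have h5 : q 5 ≠ 0 := hq.2.1.ne'
  have c : ∀ i, ContDiffAt ℝ ∞ (fun q : Config => q i) q := fun i =>
    contDiffAt_pi.1 contDiffAt_id i
  have cL : ContDiffAt ℝ ∞ L q := ((c 4).add (c 6)).add contDiffAt_const
  have ca : ContDiffAt ℝ ∞ (fun q : Config => (q 4 - q 6) * √3 / (3 * L q)) q :=
    (((c 4).sub (c 6)).mul contDiffAt_const).div (contDiffAt_const.mul cL) (by simpa using hL)
  rw [contDiffAt_pi]
  intro i
  fin_cases i
  · exact (c 2).sin.add (ca.mul (c 2).cos)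
  · exact (c 2).cos.neg.add (ca.mul (c 2).sin)
  · exact contDiffAt_const.div cL hL
  · exact ((((c 3).sin.mul contDiffAt_const).mul ((c 4).sub (c 6))).add
      ((contDiffAt_const.mul (c 3).cos).mul (cL.add contDiffAt_const)) |>.add
      (contDiffAt_const.mul (c 5))).div ((contDiffAt_const.mul (c 5)).mul cL) (by simp [hL, h5])
  · exact contDiffAt_const
  · exact contDiffAt_const
  · exact contDiffAt_const

lemma frame_succ (i : Fin 3) : frame i.succ = fun _ => Pi.single (i.natAdd 4) 1 := by
  funext q j
  fin_cases i <;> fin_cases j <;> rfl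

lemma contDiffAt_frame (hq : q ∈ Admissible) (i : Fin 4) : ContDiffAt ℝ ∞ (frame i) q := by
  cases i using Fin.cases with
  | zero => exact contDiffAt_X₁ hq
  | succ i =>
    rw [frame_succ]
    exact contDiffAt_const

lemma sum_smul_frame (q : Config) (c : Fin 4 → ℝ) : ∑ i, c i • frame i q =
    ![c 0 * X₁ q 0, c 0 * X₁ q 1, c 0 * X₁ q 2, c 0 * X₁ q 3, c 1, c 2, c 3] := by
  funext j
  fin_cases j <;> simp [Fin.sum_univ_succ, frame, X₁, X₂, X₃, X₄]

/-- Only `X₁` has a `θ`-component, the nonzero `-1 / L`; the other fields are distinct coordinate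
fields. -/
lemma linearIndependent_frame (hq : q ∈ Admissible) :
    LinearIndependent ℝ (fun i => frame i q) := by
  rw [Fintype.linearIndependent_iff]
  intro c hc
  rw [sum_smul_frame] at hc
  have h2 : c 0 * (-1 / L q) = 0 := congrFun hc 2
  have h4 : c 1 = 0 := congrFun hc 4
  have h5 : c 2 = 0 := congrFun hc 5
  have h6 : c 3 = 0 := congrFun hc 6
  have h0 : c 0 = 0 := by
    have := (L_pos hq).ne'
    simpa [this] using h2
  intro i
  fin_cases i <;> assumption

lemma frame_mem_horizontal (hq : q ∈ Admissible) (i : Fin 4) : frame i q ∈ horizontal q := by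
  have hL := (L_pos hq).ne'
  have h5 : q 5 ≠ 0 := hq.2.1.ne'
  have ht := Real.sin_sq_add_cos_sq (q 2)
  rw [mem_horizontal_iff']
  fin_cases i
  · simp only [frame, X₁, Fin.zero_eta, Matrix.cons_val]
    refine ⟨?_, ?_, ?_⟩
    · field_simp
      linear_combination 3 * L q * ht
    · field_simp
      linear_combination √3 * (q 4 - q 6) * ht
    · field_simp
  all_goals simp [frame, X₂, X₃, X₄]

lemma span_frame (hq : q ∈ Admissible) :
    Submodule.span ℝ (Set.range fun i => frame i q) = horizontal q := by
  refine le_antisymm (Submodule.span_le.2 (range_subset_iff.2 (frame_mem_horizontal hq))) ?_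
  intro v hv
  have hL := (L_pos hq).ne'
  have h5 : q 5 ≠ 0 := hq.2.1.ne'
  have ht := Real.sin_sq_add_cos_sq (q 2)
  rw [mem_horizontal_iff'] at hv
  obtain ⟨e1, e2, e3⟩ := hv
  rw [Submodule.mem_span_range_iff_exists_fun]
  -- The coefficient of `X₁` is forced by its `θ`-component `-1 / L`, the others are the leg
  -- velocities.
  refine ⟨![-L q * v 2, v 4, v 5, v 6], ?_⟩
  rw [sum_smul_frame]
  funext j
  fin_cases j
  · simp only [X₁, Fin.zero_eta, Matrix.cons_val]
    field_simp
    linear_combination -3 * Real.sin (q 2) * e1 - 3 * Real.cos (q 2) * e2 + 3 * v 0 * ht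
  · simp only [X₁, Fin.mk_one, Matrix.cons_val]
    field_simp
    linear_combination 3 * Real.cos (q 2) * e1 - 3 * Real.sin (q 2) * e2 + 3 * v 1 * ht
  · simp only [X₁, Fin.reduceFinMk, Matrix.cons_val]
    field_simp
  · simp only [X₁, Fin.reduceFinMk, Matrix.cons_val]
    field_simp
    linear_combination -3 * e3
  all_goals rfl

end Frame

/-! ### Lie brackets as leg derivatives of `X₁` -/

section Brackets

variable {q : Config}

lemma lieBracket_const (V : Config → Config) (w q : Config) :
    VectorField.lieBracket ℝ V (fun _ => w) q = -fderiv ℝ V q w := by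
  simp [VectorField.lieBracket]

/-- Restriction to a line reduces the derivative to one-variable calculus in each component. -/
lemma fderiv_X₁_eq (hq : q ∈ Admissible) {w d : Config}
    (h : ∀ j, HasDerivAt (fun t : ℝ => X₁ (q + t • w) j) (d j) 0) : fderiv ℝ X₁ q w = d := by
  have hd : DifferentiableAt ℝ X₁ q := (contDiffAt_X₁ hq).differentiableAt (by simp)
  rw [← hd.lineDeriv_eq_fderiv]
  exact (hasDerivAt_pi.2 h).deriv

/-- The derivative of `X₁` when only the leg lengths vary. -/
lemma fderiv_X₁_leg (hq : q ∈ Admissible) (a b c : ℝ) :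
    fderiv ℝ X₁ q ![0, 0, 0, 0, a, b, c] =
      ![(a * (q 6 + 1) - c * (q 4 + 1)) * 2 * √3 / (3 * L q ^ 2) * Real.cos (q 2),
        (a * (q 6 + 1) - c * (q 4 + 1)) * 2 * √3 / (3 * L q ^ 2) * Real.sin (q 2),
        (a + c) / L q ^ 2,
        (Real.sin (q 3) * (a * (q 6 + 1) - c * (q 4 + 1)) * 2 * √3 / 3
          - (a + c) * (Real.cos (q 3) + q 5)) / (q 5 * L q ^ 2)
          - b * (Real.sin (q 3) * √3 * (q 4 - q 6) + 3 * Real.cos (q 3) * (L q + 1)) /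
            (3 * q 5 ^ 2 * L q), 0, 0, 0] := by
  have hL := (L_pos hq).ne'
  have h5 : q 5 ≠ 0 := hq.2.1.ne'
  set w : Config := ![0, 0, 0, 0, a, b, c] with hw
  have z : q + (0 : ℝ) • w = q := by simp
  have hp : ∀ i, HasDerivAt (fun t : ℝ => (q + t • w) i) (w i) 0 := fun i => by
    simpa using ((hasDerivAt_id (0 : ℝ)).mul_const (w i)).const_add (q i)
  have hLd : HasDerivAt (fun t : ℝ => L (q + t • w)) (w 4 + w 6) 0 :=
    ((hp 4).add (hp 6)).add_const 2
  have hA : HasDerivAt (fun t : ℝ => ((q + t • w) 4 - (q + t • w) 6) * √3 / (3 * L (q + t • w)))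
      _ 0 := (((hp 4).sub (hp 6)).mul_const √3).div (hLd.const_mul 3) (by simpa using hL)
  have hLe : L q = q 4 + q 6 + 2 := rfl
  refine fderiv_X₁_eq hq fun j => ?_
  fin_cases j
  · have h : HasDerivAt (fun t : ℝ => X₁ (q + t • w) 0) _ 0 :=
      (hp 2).sin.add (hA.mul (hp 2).cos)
    refine h.congr_deriv ?_
    simp only [Pi.sub_apply, z]
    simp [hw]
    left
    field_simp
    rw [hLe]
    ring
  · have h : HasDerivAt (fun t : ℝ => X₁ (q + t • w) 1) _ 0 :=
      (hp 2).cos.neg.add (hA.mul (hp 2).sin)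
    refine h.congr_deriv ?_
    simp only [Pi.sub_apply, z]
    simp [hw]
    left
    field_simp
    rw [hLe]
    ring
  · have h : HasDerivAt (fun t : ℝ => X₁ (q + t • w) 2) _ 0 :=
      (hasDerivAt_const 0 (-1)).div hLd (by simpa using hL)
    refine h.congr_deriv ?_
    simp [hw]
  · have h : HasDerivAt (fun t : ℝ => X₁ (q + t • w) 3) _ 0 :=
      ((((hp 3).sin.mul_const √3).mul ((hp 4).sub (hp 6))).add
        (((hp 3).cos.const_mul 3).mul (hLd.add_const 1)) |>.add ((hp 5).const_mul 3)).div
        (((hp 5).const_mul 3).mul hLd) (by simp [hL, h5])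
    refine h.congr_deriv ?_
    simp only [Pi.sub_apply, Pi.mul_apply, Pi.add_apply, z]
    simp [hw]
    field_simp
    rw [hLe]
    ring
  all_goals exact hasDerivAt_const _ _

/-- Matches the bracket formulas, with `√3` in the denominator, to the form of `fderiv_X₁_leg`. -/
lemma div_sqrt_three_mul (a b : ℝ) : a / (√3 * b) = a * √3 / (3 * b) := by
  rcases eq_or_ne b 0 with rfl | hb
  · simp
  · field_simp
    linear_combination -a * sqrt_three_sq

/-- Proved for every `θ`, as the spanning argument needs; `θ = π / 2` is a specialization. -/
lemma X₁₂_eq (hq : q ∈ Admissible) : X₁₂ q =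
    ![-2 * (q 6 + 1) / (√3 * L q ^ 2) * Real.cos (q 2),
      -2 * (q 6 + 1) / (√3 * L q ^ 2) * Real.sin (q 2), -1 / L q ^ 2,
      (-2 * Real.sin (q 3) * (q 6 + 1) + √3 * Real.cos (q 3) + √3 * q 5) /
        (√3 * q 5 * L q ^ 2), 0, 0, 0] := by
  have hL := (L_pos hq).ne'
  have h5 : q 5 ≠ 0 := hq.2.1.ne'
  have h3 := sqrt_three_sq
  have h : X₁₂ q = _ := lieBracket_const X₁ ![0, 0, 0, 0, 1, 0, 0] q
  rw [h, fderiv_X₁_leg hq]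
  simp only [mul_assoc √3, div_sqrt_three_mul]
  funext j
  fin_cases j <;> simp
  · field_simp
  · field_simp
  · field_simp
  · field_simp
    linear_combination (-(Real.cos (q 3) + q 5)) * h3

lemma X₁₃_eq (hq : q ∈ Admissible) : X₁₃ q =
    ![0, 0, 0, (Real.sin (q 3) * (q 4 - q 6) + √3 * Real.cos (q 3) * (L q + 1)) /
      (√3 * q 5 ^ 2 * L q), 0, 0, 0] := by
  have hL := (L_pos hq).ne'
  have h5 : q 5 ≠ 0 := hq.2.1.ne'
  have h3 := sqrt_three_sq
  have h : X₁₃ q = _ := lieBracket_const X₁ ![0, 0, 0, 0, 0, 1, 0] q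
  rw [h, fderiv_X₁_leg hq]
  simp only [mul_assoc √3, div_sqrt_three_mul]
  funext j
  fin_cases j <;> simp
  field_simp
  linear_combination (-(Real.cos (q 3) * (L q + 1))) * h3

lemma X₁₄_eq (hq : q ∈ Admissible) : X₁₄ q =
    ![(2 * q 4 + 2) / (√3 * L q ^ 2) * Real.cos (q 2),
      (2 * q 4 + 2) / (√3 * L q ^ 2) * Real.sin (q 2), -1 / L q ^ 2,
      (2 * Real.sin (q 3) * (q 4 + 1) + √3 * Real.cos (q 3) + √3 * q 5) /
        (√3 * q 5 * L q ^ 2), 0, 0, 0] := by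
  have hL := (L_pos hq).ne'
  have h5 : q 5 ≠ 0 := hq.2.1.ne'
  have h3 := sqrt_three_sq
  have h : X₁₄ q = _ := lieBracket_const X₁ ![0, 0, 0, 0, 0, 0, 1] q
  rw [h, fderiv_X₁_leg hq]
  simp only [mul_assoc √3, div_sqrt_three_mul]
  funext j
  fin_cases j <;> simp
  · field_simp
    ring
  · field_simp
    ring
  · field_simp
  · field_simp
    linear_combination (-(Real.cos (q 3) + q 5)) * h3

lemma lieBracket_frame {i j : Fin 4} (hi : i ≠ 0) (hj : j ≠ 0) (q : Config) :
    VectorField.lieBracket ℝ (frame i) (frame j) q = 0 := by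
  obtain ⟨i, rfl⟩ := Fin.exists_succ_eq_of_ne_zero hi
  obtain ⟨j, rfl⟩ := Fin.exists_succ_eq_of_ne_zero hj
  rw [frame_succ, frame_succ, lieBracket_const]
  simp

end Brackets

end Trident

namespace Trident

open Set Filter Control

variable {q : Config}

/-! ### Regular configurations -/

section Regular

/-- At a regular configuration the fields and their first brackets span the tangent space. -/
lemma eq_top_of_regular (hq : q ∈ Admissible) (hr : Regular q) {M : Submodule ℝ Config}
    (h1 : X₁ q ∈ M) (h2 : X₂ q ∈ M) (h3 : X₃ q ∈ M) (h4 : X₄ q ∈ M) (h12 : X₁₂ q ∈ M)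
    (h13 : X₁₃ q ∈ M) (h14 : X₁₄ q ∈ M) : M = ⊤ := by
  have hL := (L_pos hq).ne'
  have h5 : q 5 ≠ 0 := hq.2.1.ne'
  have ht := Real.sin_sq_add_cos_sq (q 2)
  have hs : √(3 : ℝ) ≠ 0 := by positivity
  rw [X₁₂_eq hq] at h12
  rw [X₁₃_eq hq] at h13
  rw [X₁₄_eq hq] at h14
  unfold Regular at hr
  set s := Real.sin (q 3) * (q 4 - q 6) + √3 * Real.cos (q 3) * (L q + 1) with hs_def
  -- The only use of regularity: `X₁₃` is a multiple of `∂φ`, and one divides by `s`.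
  have e3 : (![0, 0, 0, 1, 0, 0, 0] : Config) ∈ M := by
    convert M.smul_mem (√3 * q 5 ^ 2 * L q / s) h13 using 1
    funext j
    fin_cases j <;> simp
    field_simp
  -- In `X₁₄ - X₁₂` the `θ`-components cancel and the planar coefficients add up to `2 / (√3 L)`,
  -- because `(ℓ₁ + 1) + (ℓ₃ + 1) = L`.
  have er : (![Real.cos (q 2), Real.sin (q 2), 0, 0, 0, 0, 0] : Config) ∈ M := by
    have h := M.smul_mem (√3 * L q / 2) (M.sub_mem h14 h12)
    convert M.sub_mem h (M.smul_mem (Real.sin (q 3) / q 5) e3) using 1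
    funext j
    have hLe : L q = q 4 + q 6 + 2 := rfl
    fin_cases j <;> simp
    · field_simp
      rw [hLe]
      ring
    · field_simp
      rw [hLe]
      ring
    · field_simp
      rw [hLe]
      ring
  have e2 : (![0, 0, 1, 0, 0, 0, 0] : Config) ∈ M := by
    have h := M.smul_mem (2 * (q 6 + 1) / (√3 * L q ^ 2)) er
    have h' := M.smul_mem ((-2 * Real.sin (q 3) * (q 6 + 1) + √3 * Real.cos (q 3) + √3 * q 5) /
        (√3 * q 5 * L q ^ 2)) e3
    convert M.smul_mem (-L q ^ 2) (M.sub_mem (M.add_mem h12 h) h') using 1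
    funext j
    fin_cases j <;> simp
    · right
      ring
    · right
      ring
    · field_simp
  -- Removing the directions already found from `X₁` leaves the normal to the previous planar
  -- vector.
  have ew : (![Real.sin (q 2), -Real.cos (q 2), 0, 0, 0, 0, 0] : Config) ∈ M := by
    have h := M.sub_mem h1 (M.smul_mem (X₁ q 3) e3)
    have h' := M.sub_mem h (M.smul_mem (X₁ q 2) e2)
    convert M.sub_mem h' (M.smul_mem ((q 4 - q 6) * √3 / (3 * L q)) er) using 1
    funext j
    fin_cases j <;> simp [X₁]
  have e0 : (![1, 0, 0, 0, 0, 0, 0] : Config) ∈ M := by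
    convert M.add_mem (M.smul_mem (Real.cos (q 2)) er) (M.smul_mem (Real.sin (q 2)) ew) using 1
    funext j
    fin_cases j <;> simp
    · linear_combination -ht
    · ring
  have e1 : (![0, 1, 0, 0, 0, 0, 0] : Config) ∈ M := by
    convert M.sub_mem (M.smul_mem (Real.sin (q 2)) er) (M.smul_mem (Real.cos (q 2)) ew) using 1
    funext j
    fin_cases j <;> simp
    · ring
    · linear_combination -ht
  refine eq_top_iff.2 fun v _ => ?_
  have s := fun {w : Config} (hw : w ∈ M) (i : Fin 7) => M.smul_mem (v i) hw
  convert M.add_mem (s e0 0) (M.add_mem (s e1 1) (M.add_mem (s e2 2) (M.add_mem (s e3 3)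
    (M.add_mem (s h2 4) (M.add_mem (s h3 5) (s h4 6)))))) using 1
  funext j
  fin_cases j <;> simp [X₂, X₃, X₄]

lemma span_fields_eq_top_iff (hq : q ∈ Admissible) :
    Submodule.span ℝ {X₁ q, X₂ q, X₃ q, X₄ q, X₁₂ q, X₁₃ q, X₁₄ q} = ⊤ ↔ Regular q := by
  refine ⟨fun h hr => ?_, fun hr => ?_⟩
  -- Without regularity `X₁₃` vanishes, and six vectors cannot span a space of dimension seven.
  · have h0 : X₁₃ q = 0 := by
      rw [X₁₃_eq hq, hr, zero_div]
      funext j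
      fin_cases j <;> rfl
    have hle : Submodule.span ℝ {X₁ q, X₂ q, X₃ q, X₄ q, X₁₂ q, X₁₃ q, X₁₄ q} ≤
        Submodule.span ℝ (range ![X₁ q, X₂ q, X₃ q, X₄ q, X₁₂ q, X₁₄ q]) := by
      have hm : ∀ i, ![X₁ q, X₂ q, X₃ q, X₄ q, X₁₂ q, X₁₄ q] i ∈
          Submodule.span ℝ (range ![X₁ q, X₂ q, X₃ q, X₄ q, X₁₂ q, X₁₄ q]) := fun i =>
        Submodule.subset_span (mem_range_self i)
      rw [Submodule.span_le, h0]
      rintro v (rfl | rfl | rfl | rfl | rfl | rfl | rfl)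
      exacts [hm 0, hm 1, hm 2, hm 3, hm 4, Submodule.zero_mem _, hm 5]
    rw [h, top_le_iff] at hle
    have hc := finrank_range_le_card (R := ℝ) ![X₁ q, X₂ q, X₃ q, X₄ q, X₁₂ q, X₁₄ q]
    rw [Set.finrank, hle, finrank_top] at hc
    simp at hc
  · refine eq_top_of_regular hq hr ?_ ?_ ?_ ?_ ?_ ?_ ?_ <;>
      exact Submodule.subset_span (by simp)

/-- Here `cos φ ≥ 1/2` and `|sin φ| ≤ √3/2`, so `S ≥ √3/2 * (ℓ₁ + ℓ₃ + 3) - √3/2 * (ℓ₁ + ℓ₃) > 0`.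
-/
lemma regular_of_abs_le (hq : q ∈ Admissible) (h : |q 3| ≤ Real.pi / 3) : Regular q := by
  obtain ⟨h4, -, h6⟩ := hq
  have hc : 1 / 2 ≤ Real.cos (q 3) := by
    rw [← Real.cos_pi_div_three, ← Real.cos_abs (q 3)]
    exact Real.cos_le_cos_of_nonneg_of_le_pi (abs_nonneg _) (by linarith [Real.pi_pos]) h
  have h3 : 0 < √(3 : ℝ) := by positivity
  have hs : |Real.sin (q 3)| ≤ √3 / 2 := by
    refine abs_le_of_sq_le_sq ?_ (by positivity)
    rw [div_pow, sqrt_three_sq, Real.sin_sq]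
    nlinarith
  have hd : |q 4 - q 6| ≤ q 4 + q 6 := abs_sub_le_iff.2 ⟨by linarith, by linarith⟩
  have hlow : -(√3 / 2 * (q 4 + q 6)) ≤ Real.sin (q 3) * (q 4 - q 6) := by
    refine (abs_le.1 ?_).1
    rw [abs_mul]
    gcongr
  have hhigh : √3 * (1 / 2) * (q 4 + q 6 + 2 + 1) ≤ √3 * Real.cos (q 3) * (L q + 1) := by
    unfold L
    gcongr
  refine ne_of_gt ?_
  nlinarith

end Regular

/-! ### Growth vector -/

section GrowthVector

lemma frame_mem_smoothSections (i : Fin 4) : frame i ∈ smoothSections Admissible horizontal :=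
  ⟨fun _ hq => (contDiffAt_frame hq i).contDiffWithinAt, fun _ hq => frame_mem_horizontal hq i⟩

lemma flagAt_zero (hq : q ∈ Admissible) : flagAt Admissible horizontal 0 q = horizontal q := by
  refine le_antisymm (Submodule.span_le.2 ?_) ?_
  · rintro _ ⟨X, hX, rfl⟩
    exact hX.2 q hq
  · rw [← span_frame hq]
    refine Submodule.span_mono (range_subset_iff.2 fun i => ?_)
    exact ⟨frame i, frame_mem_smoothSections i, rfl⟩

lemma flagAt_one (hq : q ∈ Admissible) (hr : Regular q) :
    flagAt Admissible horizontal 1 q = ⊤ := by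
  have hf : ∀ i, frame i q ∈ flagAt Admissible horizontal 1 q := fun i =>
    Submodule.subset_span ⟨frame i, Or.inl (frame_mem_smoothSections i), rfl⟩
  have hb : ∀ i j, VectorField.lieBracket ℝ (frame i) (frame j) q ∈
      flagAt Admissible horizontal 1 q := fun i j =>
    Submodule.subset_span ⟨_, Or.inr ⟨frame i, frame_mem_smoothSections i, frame j,
      frame_mem_smoothSections j, rfl⟩, rfl⟩
  exact eq_top_of_regular hq hr (hf 0) (hf 1) (hf 2) (hf 3) (hb 0 1) (hb 0 2) (hb 0 3)

lemma hasGrowthVectorAt (hq : q ∈ Admissible) (hr : Regular q) :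
    HasGrowthVectorAt Admissible horizontal q [4, 7] := by
  refine ⟨fun i => ?_, by simp⟩
  obtain ⟨i, hi⟩ := i
  -- Entry `i` of the list is the dimension of `Δⁱ⁺¹`, since `flagAt` counts from zero.
  change i < 2 at hi
  interval_cases i
  · change Module.finrank ℝ (flagAt Admissible horizontal 0 q) = 4
    rw [flagAt_zero hq, ← span_frame hq, finrank_span_eq_card (linearIndependent_frame hq)]
    rfl
  · change Module.finrank ℝ (flagAt Admissible horizontal 1 q) = 7
    rw [flagAt_one hq hr]
    simp

end GrowthVector

/-! ### Local controllability -/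

section Controllability

/-- If a differentiable map takes values in a closed subspace along a line, so does its derivative
in the direction of the line. -/
lemma fderiv_mem_of_eventually_mem {f : Config → Config} {M : Submodule ℝ Config} {w : Config}
    (hf : DifferentiableAt ℝ f q) (h : ∀ᶠ t : ℝ in 𝓝 0, f (q + t • w) ∈ M) :
    fderiv ℝ f q w ∈ M := by
  have hd := hf.hasFDerivAt.hasLineDerivAt w
  rw [HasLineDerivAt, hasDerivAt_iff_tendsto_slope_zero] at hd
  refine M.closed_of_finiteDimensional.mem_of_tendsto hd ?_
  have h0 : f (q + (0 : ℝ) • w) ∈ M := h.self_of_nhds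
  filter_upwards [h.filter_mono nhdsWithin_le_nhds] with t ht
  exact M.smul_mem _ (M.sub_mem (by simpa using ht) h0)

/-- The legs can be extended and retracted along straight lines. -/
lemma joinedBy_leg {W : Set Config} (hW : Convex ℝ W) (hWA : W ⊆ Admissible) {x : Config}
    {a b c : ℝ} (hx : x ∈ W) (hx' : x + ![0, 0, 0, 0, a, b, c] ∈ W) :
    JoinedBy frame W x (x + ![0, 0, 0, 0, a, b, c]) := by
  have h := JoinedBy.of_hasDerivAt (X := frame) (W := W)
    (γ := fun t : ℝ => x + t • ![0, 0, 0, 0, a, b, c])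
    (fun i y hy => (contDiffAt_frame (hWA hy) i).continuousAt.continuousWithinAt)
    ![0, a, b, c] (fun t _ => ?_) (fun t ht => ?_)
  · simpa using h
  · rw [sum_smul_frame]
    have := ((hasDerivAt_id t).smul_const (![0, 0, 0, 0, a, b, c] : Config)).const_add x
    refine this.congr_deriv ?_
    rw [one_smul]
    funext j
    fin_cases j <;> simp
  · exact hW.add_smul_mem hx hx' ht

/-- Every neighbourhood of an admissible configuration contains a regular configuration that differs
only in the leg lengths. -/
lemma exists_regular_leg {W : Set Config} (hW : W ∈ 𝓝 q) :
    ∃ a b c : ℝ, q + ![0, 0, 0, 0, a, b, c] ∈ W ∧ Regular (q + ![0, 0, 0, 0, a, b, c]) := by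
  by_cases hr : Regular q
  · refine ⟨0, 0, 0, ?_, ?_⟩ <;>
    · have : q + ![0, 0, 0, 0, 0, 0, 0] = q := by
        funext j
        fin_cases j <;> simp
      rw [this]
      first | exact mem_of_mem_nhds hW | exact hr
  unfold Regular at hr
  push Not at hr
  have key : ∀ w : Config, ∃ t : ℝ, t ≠ 0 ∧ q + t • w ∈ W := fun w => by
    have hc : Tendsto (fun t : ℝ => q + t • w) (𝓝[≠] 0) (𝓝 q) := by
      have : ContinuousAt (fun t : ℝ => q + t • w) 0 := by fun_prop
      simpa [ContinuousAt] using this.tendsto.mono_left nhdsWithin_le_nhds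
    obtain ⟨t, h1, h2⟩ := ((hc.eventually hW).and self_mem_nhdsWithin).exists
    exact ⟨t, h2, h1⟩
  -- `S` is affine in each leg length, with slopes `sin φ + √3 cos φ` in `ℓ₁` and `-sin φ + √3 cos
  -- φ` in `ℓ₃`. Both slopes vanish only if `sin φ = cos φ = 0`, so changing one leg leaves the zero
  -- set.
  by_cases h : Real.sin (q 3) + √3 * Real.cos (q 3) = 0
  · obtain ⟨t, ht, hmem⟩ := key ![0, 0, 0, 0, 0, 0, 1]
    have he : t • ![(0 : ℝ), 0, 0, 0, 0, 0, 1] = ![0, 0, 0, 0, 0, 0, t] := by simp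
    rw [he] at hmem
    refine ⟨0, 0, t, hmem, fun hz => ?_⟩
    simp [L] at hz hr
    have h1 : t * (-Real.sin (q 3) + √3 * Real.cos (q 3)) = 0 := by linear_combination hz - hr
    have h2 := (mul_eq_zero.1 h1).resolve_left ht
    have hs : Real.sin (q 3) = 0 := by linarith
    have hc : Real.cos (q 3) = 0 := by
      have h3 : √3 * Real.cos (q 3) = 0 := by linarith
      exact (mul_eq_zero.1 h3).resolve_left (by positivity)
    have := Real.sin_sq_add_cos_sq (q 3)
    simp [hs, hc] at this
  · obtain ⟨t, ht, hmem⟩ := key ![0, 0, 0, 0, 1, 0, 0]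
    have he : t • ![(0 : ℝ), 0, 0, 0, 1, 0, 0] = ![0, 0, 0, 0, t, 0, 0] := by simp
    rw [he] at hmem
    refine ⟨t, 0, 0, hmem, fun hz => ?_⟩
    simp [L] at hz hr
    refine h ((mul_eq_zero.1 (?_ : t * _ = 0)).resolve_left ht)
    linear_combination hz - hr

lemma locallyControllableAt (hq : q ∈ Admissible) : LocallyControllableAt frame q := by
  intro W hW
  obtain ⟨ε, hε, hball⟩ := Metric.mem_nhds_iff.1
    (inter_mem hW (isOpen_admissible.mem_nhds hq))
  -- A ball is convex, so straight leg motions between its points stay inside.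
  set B := Metric.ball q ε with hB
  have hBW : B ⊆ W := hball.trans inter_subset_left
  have hBA : B ⊆ Admissible := hball.trans inter_subset_right
  have hBo : IsOpen B := Metric.isOpen_ball
  have hqB : q ∈ B := Metric.mem_ball_self hε
  have hX : ∀ i, ContinuousOn (frame i) B := fun i y hy =>
    (contDiffAt_frame (hBA hy) i).continuousAt.continuousWithinAt
  have hfield : ∀ y ∈ B, ∀ i, HasLocalMotion frame B y (frame i y) := fun y hy i =>
    hasLocalMotion_field hX (hBo.mem_nhds hy) i ((contDiffAt_frame (hBA hy) i).of_le (by simp))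
  set M := Submodule.span ℝ {v | HasLocalMotion frame B q v} with hM
  have hmem : ∀ a b c : ℝ, q + ![0, 0, 0, 0, a, b, c] ∈ B →
      X₁ (q + ![0, 0, 0, 0, a, b, c]) ∈ M := by
    intro a b c h
    refine Submodule.subset_span (HasLocalMotion.of_translate ?_ (hfield _ h 0))
    have hc : ContinuousAt (fun x : Config => x + ![0, 0, 0, 0, a, b, c]) q := by fun_prop
    filter_upwards [hBo.mem_nhds hqB, hc.eventually (hBo.mem_nhds h)] with x h1 h2
    exact joinedBy_leg (convex_ball q ε) hBA h1 h2
  have hconst : ∀ i, frame i q ∈ M := fun i => Submodule.subset_span (hfield q hqB i)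
  obtain ⟨a, b, c, hp, hr⟩ := exists_regular_leg (hBo.mem_nhds hqB)
  set p : Config := q + ![0, 0, 0, 0, a, b, c] with hpdef
  have hbr : ∀ a' b' c' : ℝ,
      VectorField.lieBracket ℝ X₁ (fun _ => ![0, 0, 0, 0, a', b', c']) p ∈ M := by
    intro a' b' c'
    rw [lieBracket_const]
    -- Near `p` the leg line through `p` consists of leg translates of `q` in `B`, where `X₁` takes
    -- values in `M`.
    refine M.neg_mem (fderiv_mem_of_eventually_mem
      ((contDiffAt_X₁ (hBA hp)).differentiableAt (by simp)) ?_)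
    have hc : ContinuousAt (fun t : ℝ => p + t • ![0, 0, 0, 0, a', b', c']) 0 := by fun_prop
    filter_upwards [hc.eventually (p := fun x => x ∈ B) (by simpa using hBo.mem_nhds hp)] with t ht
    have he : p + t • ![0, 0, 0, 0, a', b', c'] =
        q + ![0, 0, 0, 0, a + t * a', b + t * b', c + t * c'] := by
      rw [hpdef, add_assoc]
      simp
    rw [he] at ht ⊢
    exact hmem _ _ _ ht
  -- Spanning is checked at the regular `p`, although `M` belongs to `q`: `X₂`, `X₃`, `X₄` are
  -- constant, so their values at `q` serve at `p`.
  have htop : M = ⊤ := eq_top_of_regular (hBA hp) hr (hmem a b c hp) (hconst 1) (hconst 2)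
    (hconst 3) (hbr 1 0 0) (hbr 0 1 0) (hbr 0 0 1)
  obtain ⟨V, hV, hVj⟩ := exists_nhds_joinedBy hqB htop
  exact ⟨V, hV, fun p hp => (hVj p hp).mono hBW⟩

end Controllability

end Trident

theorem mainTheorem1 :
    -- the Pfaff system expresses that no wheel slips sideways
    (∀ q v : Trident.Config, v ∈ Trident.horizontal q ↔ Trident.NoSideSlip q v) ∧
    -- `X₁, …, X₄` are smooth and form a basis of the solution space of the Pfaff system
    (∀ i, ContDiffOn ℝ ∞ (Trident.frame i) Trident.Admissible) ∧
    (∀ q ∈ Trident.Admissible,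
      LinearIndependent ℝ (fun i => Trident.frame i q) ∧
      Submodule.span ℝ (Set.range fun i => Trident.frame i q) = Trident.horizontal q) ∧
    -- the fields and their brackets at the points with `θ = π / 2`
    (∀ q ∈ Trident.Admissible, q 2 = Real.pi / 2 →
      Trident.X₁ q =
        ![1, (q 4 - q 6) * √3 / (3 * Trident.L q), -1 / Trident.L q,
          (Real.sin (q 3) * √3 * (q 4 - q 6) + 3 * Real.cos (q 3) * (Trident.L q + 1)
            + 3 * q 5) / (3 * q 5 * Trident.L q), 0, 0, 0] ∧
      Trident.X₁₂ q =
        ![0, -2 * (q 6 + 1) / (√3 * Trident.L q ^ 2), -1 / Trident.L q ^ 2,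
          (-2 * Real.sin (q 3) * (q 6 + 1) + √3 * Real.cos (q 3) + √3 * q 5) /
            (√3 * q 5 * Trident.L q ^ 2), 0, 0, 0] ∧
      Trident.X₁₃ q =
        ![0, 0, 0, (Real.sin (q 3) * (q 4 - q 6) + √3 * Real.cos (q 3) * (Trident.L q + 1)) /
            (√3 * q 5 ^ 2 * Trident.L q), 0, 0, 0] ∧
      Trident.X₁₄ q =
        ![0, (2 * q 4 + 2) / (√3 * Trident.L q ^ 2), -1 / Trident.L q ^ 2,
          (2 * Real.sin (q 3) * (q 4 + 1) + √3 * Real.cos (q 3) + √3 * q 5) /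
            (√3 * q 5 * Trident.L q ^ 2), 0, 0, 0]) ∧
    -- the remaining brackets of the four fields vanish
    (∀ i j : Fin 4, i ≠ 0 → j ≠ 0 → ∀ q,
      VectorField.lieBracket ℝ (Trident.frame i) (Trident.frame j) q = 0) ∧
    -- the seven fields span the tangent space exactly at the regular configurations
    (∀ q ∈ Trident.Admissible,
      Submodule.span ℝ {Trident.X₁ q, Trident.X₂ q, Trident.X₃ q, Trident.X₄ q,
        Trident.X₁₂ q, Trident.X₁₃ q, Trident.X₁₄ q} = ⊤ ↔ Trident.Regular q) ∧
    -- which include all those with `φ` not too far from `0`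
    (∀ q ∈ Trident.Admissible, |q 3| ≤ Real.pi / 3 → Trident.Regular q) ∧
    -- growth vector `(4, 7)`
    (∀ q ∈ Trident.Admissible, Trident.Regular q →
      Control.HasGrowthVectorAt Trident.Admissible Trident.horizontal q [4, 7]) ∧
    -- local controllability
    (∀ q ∈ Trident.Admissible, Control.LocallyControllableAt Trident.frame q) ∧
    -- any two configurations can be joined by a horizontal trajectory
    (∀ q ∈ Trident.Admissible, ∀ p ∈ Trident.Admissible,
      Control.JoinedBy Trident.frame Trident.Admissible q p) := by
  refine ⟨Trident.mem_horizontal_iff_noSideSlip,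
    fun i q hq => (Trident.contDiffAt_frame hq i).contDiffWithinAt,
    fun q hq => ⟨Trident.linearIndependent_frame hq, Trident.span_frame hq⟩,
    fun q hq hθ => ⟨?_, ?_, Trident.X₁₃_eq hq, ?_⟩,
    fun i j hi hj q => Trident.lieBracket_frame hi hj q,
    fun q hq => Trident.span_fields_eq_top_iff hq,
    fun q hq h => Trident.regular_of_abs_le hq h,
    fun q hq hr => Trident.hasGrowthVectorAt hq hr,
    fun q hq => Trident.locallyControllableAt hq,
    fun q hq p hp => Control.joinedBy_of_isPreconnected Trident.isOpen_admissible
      Trident.convex_admissible.isPreconnected (fun _ h => Trident.locallyControllableAt h) hq hp⟩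
  · simp [Trident.X₁, hθ]
  · simp [Trident.X₁₂_eq hq, hθ]
  · simp [Trident.X₁₄_eq hq, hθ]
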